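/- Let $\Sigma$ be a manifold of positive dimension, possibly with boundary, and let $\mu$ be a Borel probability measure on $\Sigma$ whose support contains a nonempty open set. Let $G$ be a weakly connected digraph, possibly with self-loops, on $n+1$ nodes: $n$ state nodes $\alpha_1,\dots,\alpha_n$ and one input node $\beta$, where $\beta$ has no in-neighbor. A pair of bounded continuous functions $A:\Sigma\to\mathbb R^{n\times n}$, $b:\Sigma\to\mathbb R^n$ is compliant with $G$ if $G$ has the edge $\alpha_j\to\alpha_i$ whenever the entry $a_{ij}$ is not identically zero, and the edge $\beta\to\alpha_i$ whenever $b_i$ is not identically zero. The pair is averaged controllable if for every bounded continuous $\chi_0:\Sigma\to\mathbb R^n$, every $x^*\in\mathbb R^n$ and every $T>0$ there is a locally integrable input $u:[0,\infty)\to\mathbb R$ such that the solution of $$\tfrac{\partial}{\partial t}x(t,\sigma)=A(\sigma)x(t,\sigma)+b(\sigma)u(t),\qquad x(0,\sigma)=\chi_0(\sigma),\quad \sigma\in\Sigma,$$ satisfies $\int_\Sigma x(T,\sigma)\,d\mu(\sigma)=x^*$. The digraph $G$ is structurally averaged controllable (with respect to $\Sigma$ and $\mu$) if some bounded continuous pair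 $(A,b)$ compliant with $G$ is averaged controllable. The core $G^*$ of $G$ is the subgraph induced by the nodes that are not successors of any cycle of $G$ (self-loops count as cycles, and the nodes of a cycle are successors of it). Then $G$ is structurally averaged controllable if and only if every node of $G$ can be reached from $\beta$ by a directed path and $G^*$ contains a directed spanning path. In particular, if every node of $G$ is reachable from $\beta$, then $G$ is structurally averaged controllable if and only if $G^*$ contains a directed spanning path. -/

import Mathlib

open MeasureTheory Set
open scoped Matrix BoundedContinuousFunction

namespace AveragedControl

/-! ## Digraphs

A sparsity pattern is a digraph, possibly with self-loops, on the nodes `Fin n ⊕ Unit`: the state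
nodes are `α i = Sum.inl i` and the single input node is `β = Sum.inr ()`. -/

/-- The input node. -/
abbrev inputNode (n : ℕ) : Fin n ⊕ Unit := Sum.inr ()

section Graph

variable {V : Type*}

/-- `w` is a successor of `v` if there is a path from `v` to `w`; a single node is a path, so that
every node is a successor of itself. -/
def IsSuccessor (G : Digraph V) (v w : V) : Prop :=
  Relation.ReflTransGen G.Adj v w

/-- A root: every node is a successor of it. -/
def IsRoot (G : Digraph V) (r : V) : Prop :=
  ∀ v, IsSuccessor G r v

/-- The node set of the strong component of `v`. -/
def strongComponent (G : Digraph V) (v : V) : Set V :=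
  {w | IsSuccessor G v w ∧ IsSuccessor G w v}

/-- The union of the nontrivial strong components, that is, of those which are not just a single
node without self-loop. Equivalently, the nodes that lie on a cycle. -/
def cycNodes (G : Digraph V) : Set V :=
  {v | ¬ (strongComponent G v = {v} ∧ ¬ G.Adj v v)}

/-- The set of successors of nodes lying on a cycle. -/
def cycSuccessors (G : Digraph V) : Set V :=
  {w | ∃ v ∈ cycNodes G, IsSuccessor G v w}

/-- The subgraph induced by a set of nodes. -/
def inducedSubgraph (G : Digraph V) (S : Set V) : Digraph S where
  Adj v w := G.Adj v w

/-- The core: the subgraph induced by the nodes which are not successors of a cycle. -/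
def core (G : Digraph V) : Digraph ↥(cycSuccessors G)ᶜ :=
  inducedSubgraph G (cycSuccessors G)ᶜ

/-- There is a directed path (a nonempty sequence of pairwise distinct nodes, consecutive ones being
joined by an edge) which visits all nodes. -/
def HasDirectedSpanningPath (G : Digraph V) : Prop :=
  ∃ l : List V, l ≠ [] ∧ l.Nodup ∧ l.IsChain G.Adj ∧ ∀ v, v ∈ l

end Graph

/-- The weakly connected digraphs on `n` state nodes and one input node without in-neighbors. -/
structure IsSparsityPattern {n : ℕ} (G : Digraph (Fin n ⊕ Unit)) : Prop where
  weaklyConnected : G.toSimpleGraphInclusive.Connected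
  input_no_inNeighbor : ∀ v, ¬ G.Adj v (inputNode n)

/-! ## Ensembles of linear control systems

The parameter space is `M`; a bounded continuous pair `(A, b)` is given by
`A : M →ᵇ (Fin n → Fin n → ℝ)` (an `n × n` matrix depending on the parameter) and
`b : M →ᵇ (Fin n → ℝ)`. Boundedness does not depend on the norm on the finite-dimensional
target. -/

section Ensemble

variable {M : Type*} [TopologicalSpace M] {n : ℕ}

/-- The digraph induced by `(A, b)`: there is an edge from `α j` to `α i` if the entry `A i j` is
not the zero function, and an edge from `β` to `α i` if `b i` is not the zero function. -/
def inducedDigraph (A : M →ᵇ (Fin n → Fin n → ℝ)) (b : M →ᵇ (Fin n → ℝ)) :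
    Digraph (Fin n ⊕ Unit) where
  Adj v w :=
    match v, w with
    | Sum.inl j, Sum.inl i => ∃ σ, A σ i j ≠ 0
    | Sum.inr _, Sum.inl i => ∃ σ, b σ i ≠ 0
    | _, Sum.inr _ => False

/-- `(A, b)` is compliant with `G` if its induced digraph is a subgraph of `G`. -/
def IsCompliant (G : Digraph (Fin n ⊕ Unit))
    (A : M →ᵇ (Fin n → Fin n → ℝ)) (b : M →ᵇ (Fin n → ℝ)) : Prop :=
  inducedDigraph A b ≤ G

/-- Admissible inputs: integrable on `[0, T]` for every `T > 0`. -/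
def IsAdmissible (u : ℝ → ℝ) : Prop :=
  ∀ T : ℝ, 0 < T → IntegrableOn u (Icc 0 T)

/-- `x t σ` solves `∂x/∂t (t, σ) = A(σ) x(t, σ) + b(σ) u(t)` for `t ≥ 0`, with initial profile `x₀`
(Carathéodory solution: for each `σ` the integrated equation holds). -/
structure IsSolution (A : M →ᵇ (Fin n → Fin n → ℝ)) (b : M →ᵇ (Fin n → ℝ)) (u : ℝ → ℝ)
    (x₀ : M →ᵇ (Fin n → ℝ)) (x : ℝ → M → (Fin n → ℝ)) : Prop where
  continuousOn : ∀ σ, ContinuousOn (fun t => x t σ) (Ici 0)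
  integral_eq : ∀ σ, ∀ t : ℝ, 0 ≤ t →
    x t σ = x₀ σ + ∫ s in (0 : ℝ)..t, (Matrix.of (A σ) *ᵥ x s σ + u s • b σ)

variable [MeasurableSpace M]

/-- Averaged controllability: every initial profile can be steered, in any positive time, so that
the average of the states is any prescribed vector. -/
def IsAveragedControllable (μ : Measure M)
    (A : M →ᵇ (Fin n → Fin n → ℝ)) (b : M →ᵇ (Fin n → ℝ)) : Prop :=
  ∀ (x₀ : M →ᵇ (Fin n → ℝ)) (target : Fin n → ℝ) (T : ℝ), 0 < T →
    ∃ u : ℝ → ℝ, IsAdmissible u ∧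
      ∃ x : ℝ → M → (Fin n → ℝ), IsSolution A b u x₀ x ∧
        Integrable (x T) μ ∧ ∫ σ, x T σ ∂μ = target

/-- `G` is structurally averaged controllable, with respect to the parameter space `M` and the
measure `μ`: some bounded continuous pair compliant with `G` is averaged controllable. -/
def IsStructurallyAveragedControllable (μ : Measure M) (G : Digraph (Fin n ⊕ Unit)) : Prop :=
  ∃ (A : M →ᵇ (Fin n → Fin n → ℝ)) (b : M →ᵇ (Fin n → ℝ)),
    IsCompliant G A b ∧ IsAveragedControllable μ A b

end Ensemble

end AveragedControl

/-!
Write `C` for the set of core nodes and `N` for its complement, the successors of cycles.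

Necessity. From a zero initial profile, the states that cannot be reached from the input solve a
homogeneous linear equation and vanish (`isRoot_of_isAveragedControllable`). The set `C` is closed
under predecessors and acyclic, so that the core states from a zero initial profile are finite
combinations `∑ (A ^ k b) · u_{k+1}(t)`, where the `u_k` are the iterated integrals of the input
(`IsSolution.core_eq`). A nonzero entry of `A ^ k b` at a core node yields a path in `C` with
`k + 1` edges that starts at the input. Without a spanning path of the core, fewer exponents `k`
occur than there are core states, and the averages of the core states fill a proper subspace only
(`core_hasDirectedSpanningPath_of_isAveragedControllable`).

Sufficiency. The ensemble is a linear system with a bounded operator in the Banach space of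
bounded continuous profiles, and a duality argument shows that it is averaged controllable as soon
as the vectors `∫ A ^ k b dμ` span `ℝⁿ` (`isAveragedControllable_of_krylov`). Inside `G`, keep the
spanning path of the core, all edges leaving the core, and for each node of `N` one edge
`parent v → v` from `N`, in such a way that each orbit of `parent` meets nodes entered from the
core. Let `B` and `b₀` be the 0-1 matrix and vector of this subgraph. The entries `w_i(k)` of
`B ^ k b₀` count walks of `k + 1` edges from the input; for large `k` they vanish on the core, and
on `N` they are transported by `parent`, hence periodic in `k` with some period `P`, and they do
not die out (`exists_subgraph_walkCount`).

Take a continuous `φ : M → [1, 2]` with infinitely many values on the support of `μ`, let `D` be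
the diagonal matrix with entries `φ ^ (P i)`, and put `A = φ D B D⁻¹`, `b = D b₀`. Then
`(A ^ k b)_i = φ ^ (k + P i) w_i(k)` (`krylov_weighted`). If `∑ c_i ∫ (A ^ k b)_i dμ = 0` for all
`k`, then along a residue class of large `k` modulo `P` the moments `∫ φ ^ k Q(φ ^ P) dμ` of the
polynomial `Q(x) = ∑ c_i w_i(k) x ^ i` vanish; they combine to `∫ φ ^ k Q(φ ^ P) ^ 2 dμ = 0`, so
`Q` has infinitely many roots and is zero (`polynomial_eq_zero_of_moments`). This kills `c` on
`N`. On the core, the vectors `w(k)` for small `k` restrict to the unit vectors, and `c` vanishes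
there as well.
-/

namespace AveragedControl

/-! ### The core of a digraph -/

section CoreFacts

variable {V : Type*} {G : Digraph V}

lemma mem_cycNodes_of_transGen {v : V} (h : Relation.TransGen G.Adj v v) : v ∈ cycNodes G := by
  rintro ⟨hs, hl⟩
  obtain ⟨w, hvw, hwv⟩ := Relation.TransGen.head'_iff.1 h
  have hw : w ∈ strongComponent G v := ⟨Relation.ReflTransGen.single hvw, hwv⟩
  rw [hs] at hw
  obtain rfl : w = v := hw
  exact hl hvw

lemma exists_adj_of_mem_cycNodes {v : V} (h : v ∈ cycNodes G) :
    ∃ w ∈ cycNodes G, G.Adj w v := by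
  by_contra! hc
  have key : ∀ w, IsSuccessor G v w → IsSuccessor G w v → w = v := by
    intro w hvw hwv
    rcases Relation.ReflTransGen.cases_tail hwv with h' | ⟨c, hwc, hcv⟩
    · exact h'.symm
    · refine absurd hcv (hc c (mem_cycNodes_of_transGen ?_))
      exact Relation.TransGen.head' hcv (hvw.trans hwc)
  refine h ⟨?_, hc v h⟩
  ext w
  exact ⟨fun hw => key w hw.1 hw.2, fun hw => hw ▸ ⟨.refl, .refl⟩⟩

lemma cycSuccessors_of_adj {v w : V} (h : G.Adj v w) (hv : v ∈ cycSuccessors G) :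
    w ∈ cycSuccessors G := by
  obtain ⟨c, hc, hcv⟩ := hv
  exact ⟨c, hc, hcv.tail h⟩

/-- Every successor of a cycle has an in-neighbor of the same kind. -/
lemma exists_adj_of_mem_cycSuccessors {w : V} (h : w ∈ cycSuccessors G) :
    ∃ v ∈ cycSuccessors G, G.Adj v w := by
  obtain ⟨c, hc, hcw⟩ := h
  rcases Relation.ReflTransGen.cases_tail hcw with rfl | ⟨d, hcd, hdw⟩
  · obtain ⟨v, hv, hvw⟩ := exists_adj_of_mem_cycNodes hc
    exact ⟨v, ⟨v, hv, .refl⟩, hvw⟩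
  · exact ⟨d, ⟨c, hc, hcd⟩, hdw⟩

lemma core_adj {v w : ↥(cycSuccessors G)ᶜ} : (core G).Adj v w ↔ G.Adj v w := Iff.rfl

lemma core_not_transGen (v : ↥(cycSuccessors G)ᶜ) : ¬ Relation.TransGen (core G).Adj v v := by
  intro h
  have h' : Relation.TransGen G.Adj (v : V) v :=
    Relation.TransGen.lift Subtype.val (fun _ _ h => h) _ _ h
  exact v.2 ⟨v, mem_cycNodes_of_transGen h', .refl⟩

lemma core_wellFounded [Finite V] : WellFounded (core G).Adj := by
  have : Std.Irrefl (Relation.TransGen (core G).Adj) := ⟨core_not_transGen⟩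
  have hwf : WellFounded (Relation.TransGen (core G).Adj) :=
    Finite.wellFounded_of_trans_of_irrefl _
  exact Subrelation.wf (fun h => Relation.TransGen.single h) hwf

/-- A chain of the core, read against the direction of the edges, has no repetition, since the
core is acyclic. -/
lemma core_nodup_of_isChain {l : List ↥(cycSuccessors G)ᶜ}
    (h : l.IsChain fun v w => (core G).Adj w v) : l.Nodup := by
  have h1 : l.IsChain (Function.swap (Relation.TransGen (core G).Adj)) :=
    h.imp fun _ _ h => Relation.TransGen.single h
  have : IsTrans _ (Function.swap (Relation.TransGen (core G).Adj)) :=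
    ⟨fun _ _ _ h₁ h₂ => Relation.TransGen.trans h₂ h₁⟩
  refine (List.isChain_iff_pairwise.1 h1).imp fun {a b} hab => ?_
  rintro rfl
  exact core_not_transGen _ hab

lemma core_hasDirectedSpanningPath_of_chain [Finite V] {l : List ↥(cycSuccessors G)ᶜ}
    (h : l.IsChain fun v w => (core G).Adj w v) (hl : l ≠ [])
    (hcard : Nat.card ↥(cycSuccessors G)ᶜ ≤ l.length) : HasDirectedSpanningPath (core G) := by
  classical
  have := Fintype.ofFinite ↥(cycSuccessors G)ᶜ
  have hnd := core_nodup_of_isChain h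
  refine ⟨l.reverse, by simpa using hl, List.nodup_reverse.2 hnd, List.isChain_reverse.2 h, ?_⟩
  intro v
  rw [Nat.card_eq_fintype_card, ← List.toFinset_card_of_nodup hnd] at hcard
  have huniv := Finset.eq_univ_of_card _ (le_antisymm (Finset.card_le_univ _) hcard)
  have hv := Finset.mem_univ v
  rw [← huniv] at hv
  simpa using hv

end CoreFacts

section PatternFacts

variable {n : ℕ} {G : Digraph (Fin n ⊕ Unit)}

lemma IsSparsityPattern.eq_of_isSuccessor (hG : IsSparsityPattern G) {v : Fin n ⊕ Unit}
    (h : IsSuccessor G v (inputNode n)) : v = inputNode n := by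
  rcases Relation.ReflTransGen.cases_tail h with h | ⟨c, _, hc⟩
  · exact h.symm
  · exact absurd hc (hG.input_no_inNeighbor c)

lemma IsSparsityPattern.inputNode_mem_core (hG : IsSparsityPattern G) :
    inputNode n ∈ (cycSuccessors G)ᶜ := by
  rintro ⟨v, hv, hvi⟩
  obtain rfl := hG.eq_of_isSuccessor hvi
  obtain ⟨w, -, hw⟩ := exists_adj_of_mem_cycNodes hv
  exact hG.input_no_inNeighbor w hw

end PatternFacts

/-! ### The ensemble as a linear system in the space of profiles -/

section Operator

variable {M : Type*} [TopologicalSpace M] {n : ℕ}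

lemma norm_mulVec_le (B : Fin n → Fin n → ℝ) (v : Fin n → ℝ) :
    ‖Matrix.of B *ᵥ v‖ ≤ n * ‖B‖ * ‖v‖ := by
  refine (pi_norm_le_iff_of_nonneg (by positivity)).2 fun i => ?_
  calc ‖∑ j, B i j * v j‖ ≤ ∑ _j : Fin n, ‖B‖ * ‖v‖ := by
        refine norm_sum_le_of_le _ fun j _ => ?_
        rw [norm_mul]
        exact mul_le_mul ((norm_le_pi_norm (B i) j).trans (norm_le_pi_norm B i))
          (norm_le_pi_norm v j) (norm_nonneg _) (norm_nonneg _)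
    _ = n * ‖B‖ * ‖v‖ := by simp [mul_assoc]

/-- The bounded linear operator `x ↦ A x` on the Banach space of bounded continuous profiles, where
`(A x)(σ) = A(σ) x(σ)`. -/
noncomputable def stateOp (A : M →ᵇ (Fin n → Fin n → ℝ)) :
    (M →ᵇ (Fin n → ℝ)) →L[ℝ] (M →ᵇ (Fin n → ℝ)) :=
  LinearMap.mkContinuous
    { toFun := fun x => BoundedContinuousFunction.ofNormedAddCommGroup
        (fun σ => Matrix.of (A σ) *ᵥ x σ)
        (Continuous.matrix_mulVec (by exact A.continuous) x.continuous)
        (n * ‖A‖ * ‖x‖) (fun σ => (norm_mulVec_le _ _).trans (by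
          gcongr
          · exact A.norm_coe_le_norm σ
          · exact x.norm_coe_le_norm σ))
      map_add' := fun x y => by ext σ i; simp [Matrix.mulVec_add]
      map_smul' := fun c x => by ext σ i; simp [Matrix.mulVec_smul] }
    (n * ‖A‖) (fun x => BoundedContinuousFunction.norm_ofNormedAddCommGroup_le _
      (by positivity) fun σ => (norm_mulVec_le _ _).trans (by
        gcongr
        · exact A.norm_coe_le_norm σ
        · exact x.norm_coe_le_norm σ))

/-- The profile `A ^ k b`. -/
noncomputable def krylov (A : M →ᵇ (Fin n → Fin n → ℝ)) (b : M →ᵇ (Fin n → ℝ)) (k : ℕ) :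
    M →ᵇ (Fin n → ℝ) :=
  (stateOp A ^ k) b

lemma krylov_zero (A : M →ᵇ (Fin n → Fin n → ℝ)) (b : M →ᵇ (Fin n → ℝ)) :
    krylov A b 0 = b := by simp [krylov]

lemma krylov_succ (A : M →ᵇ (Fin n → Fin n → ℝ)) (b : M →ᵇ (Fin n → ℝ)) (k : ℕ) :
    krylov A b (k + 1) = stateOp A (krylov A b k) := by
  simp [krylov, pow_succ']

lemma krylov_succ_apply (A : M →ᵇ (Fin n → Fin n → ℝ)) (b : M →ᵇ (Fin n → ℝ)) (k : ℕ) (σ : M)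
    (i : Fin n) : krylov A b (k + 1) σ i = ∑ j, A σ i j * krylov A b k σ j := by
  rw [krylov_succ]; rfl

end Operator

/-! ### Necessity of reachability -/

section NecessityRoot

variable {M : Type*} [TopologicalSpace M] {n : ℕ} {G : Digraph (Fin n ⊕ Unit)}
  {A : M →ᵇ (Fin n → Fin n → ℝ)} {b : M →ᵇ (Fin n → ℝ)} {u : ℝ → ℝ}
  {x : ℝ → M → (Fin n → ℝ)}

lemma IsCompliant.adj_of_entry_ne_zero (h : IsCompliant G A b) {σ : M} {i j : Fin n}
    (hij : A σ i j ≠ 0) : G.Adj (Sum.inl j) (Sum.inl i) :=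
  h (show (inducedDigraph A b).Adj (Sum.inl j) (Sum.inl i) from ⟨σ, hij⟩)

lemma IsCompliant.adj_of_input_ne_zero (h : IsCompliant G A b) {σ : M} {i : Fin n}
    (hi : b σ i ≠ 0) : G.Adj (inputNode n) (Sum.inl i) :=
  h (show (inducedDigraph A b).Adj (Sum.inr ()) (Sum.inl i) from ⟨σ, hi⟩)

lemma IsAdmissible.intervalIntegrable (hu : IsAdmissible u) {t : ℝ} (ht : 0 ≤ t) :
    IntervalIntegrable u volume 0 t := by
  rcases ht.eq_or_lt with rfl | ht
  · exact IntervalIntegrable.refl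
  · rw [intervalIntegrable_iff_integrableOn_Icc_of_le ht.le]
    exact hu t ht

/-- The integrated equation, read componentwise. -/
lemma IsSolution.component_eq {x₀ : M →ᵇ (Fin n → ℝ)} (hx : IsSolution A b u x₀ x)
    (hu : IsAdmissible u) (σ : M) {t : ℝ} (ht : 0 ≤ t) (i : Fin n) :
    x t σ i = x₀ σ i + ∫ s in (0 : ℝ)..t, ((∑ j, A σ i j * x s σ j) + u s * b σ i) := by
  have hsub : uIcc 0 t ⊆ Ici 0 := by rw [uIcc_of_le ht]; exact Icc_subset_Ici_self
  have hcont : ContinuousOn (fun s => Matrix.of (A σ) *ᵥ x s σ) (uIcc 0 t) :=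
    (Continuous.matrix_mulVec continuous_const continuous_id).comp_continuousOn
      ((hx.continuousOn σ).mono hsub)
  have hint : IntervalIntegrable (fun s => Matrix.of (A σ) *ᵥ x s σ + u s • b σ) volume 0 t :=
    hcont.intervalIntegrable.add ⟨(hu.intervalIntegrable ht).1.smul_const _,
      (hu.intervalIntegrable ht).2.smul_const _⟩
  rw [hx.integral_eq σ t ht, Pi.add_apply]
  congr 1
  exact ((ContinuousLinearMap.proj (R := ℝ) (φ := fun _ : Fin n => ℝ) i).intervalIntegral_comp_comm
    hint).symm

/-- A continuous solution of a homogeneous linear integral equation vanishes. -/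
lemma eq_zero_of_eq_integral_mulVec (B : Fin n → Fin n → ℝ) {y : ℝ → Fin n → ℝ}
    (hy : ContinuousOn y (Ici 0))
    (h : ∀ t, 0 ≤ t → y t = ∫ s in (0 : ℝ)..t, Matrix.of B *ᵥ y s) {t : ℝ} (ht : 0 ≤ t) :
    y t = 0 := by
  -- Extending `y` to the left by its initial value makes the primitive differentiable everywhere.
  set g : ℝ → Fin n → ℝ := fun s => Matrix.of B *ᵥ y (max s 0) with hg
  have hgc : Continuous g := Continuous.matrix_mulVec continuous_const
    (hy.comp_continuous (continuous_id.max continuous_const) fun s => le_max_right s 0)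
  have hF : ∀ s, 0 ≤ s → ∫ r in (0 : ℝ)..s, g r = y s := by
    intro s hs
    rw [h s hs]
    refine intervalIntegral.integral_congr fun r hr => ?_
    rw [uIcc_of_le hs] at hr
    simp [hg, max_eq_left hr.1]
  have hder := fun s => (hgc.integral_hasStrictDerivAt 0 s).hasDerivAt
  have := norm_le_gronwallBound_of_norm_deriv_right_le (δ := 0) (ε := 0) (K := n * ‖B‖)
    (a := 0) (b := t) (f := fun s => ∫ r in (0 : ℝ)..s, g r) (f' := g)
    (fun s _ => (hder s).continuousAt.continuousWithinAt)
    (fun s _ => (hder s).hasDerivWithinAt) (by simp) (fun s hs => by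
      rw [hF s hs.1, add_zero]
      simpa [hg, max_eq_left hs.1] using norm_mulVec_le B (y s)) t ⟨ht, le_rfl⟩
  rw [hF t ht, gronwallBound_ε0_δ0] at this
  exact norm_le_zero_iff.1 this

lemma integral_apply_of_integrable {Ω : Type*} [MeasurableSpace Ω] {μ : Measure Ω}
    {f : Ω → Fin n → ℝ} (hf : Integrable f μ) (i : Fin n) :
    (∫ σ, f σ ∂μ) i = ∫ σ, f σ i ∂μ :=
  ((ContinuousLinearMap.proj (R := ℝ) (φ := fun _ : Fin n => ℝ) i).integral_comp_comm hf).symm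

variable [MeasurableSpace M] {μ : Measure M}

/-- State nodes that are not reached from the input keep the value `0` from a zero initial profile,
so that averaged controllability makes the input node a root. -/
lemma isRoot_of_isAveragedControllable (hc : IsCompliant G A b)
    (h : IsAveragedControllable μ A b) : IsRoot G (inputNode n) := by
  classical
  rintro (i | ⟨⟩)
  swap
  · exact Relation.ReflTransGen.refl
  by_contra hi
  obtain ⟨u, hu, x, hx, hint, htarget⟩ := h 0 (Pi.single i 1) 1 one_pos
  have key : ∀ σ, x 1 σ i = 0 := by
    intro σ
    set S : Set (Fin n) := {j | ¬ IsSuccessor G (inputNode n) (Sum.inl j)}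
    set y : ℝ → Fin n → ℝ := fun t j => if j ∈ S then x t σ j else 0 with hy
    have hyc : ContinuousOn y (Ici 0) := by
      refine continuousOn_pi.2 fun j => ?_
      by_cases hj : j ∈ S
      · simpa [hy, hj] using continuousOn_pi.1 (hx.continuousOn σ) j
      · simpa [hy, hj] using continuousOn_const
    set B : Fin n → Fin n → ℝ := fun j k => if j ∈ S then A σ j k else 0 with hB
    have hBy : ∀ s j, (Matrix.of B *ᵥ y s) j =
        if j ∈ S then (∑ k, A σ j k * x s σ k) + u s * b σ j else 0 := by
      intro s j
      change ∑ k, B j k * y s k = _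
      by_cases hj : j ∈ S
      · have hb : b σ j = 0 := by
          by_contra hb
          exact hj (Relation.ReflTransGen.single (hc.adj_of_input_ne_zero hb))
        simp only [hB, hj, if_true, hb, mul_zero, add_zero]
        refine Finset.sum_congr rfl fun k _ => ?_
        by_cases hk : k ∈ S
        · simp [hy, hk]
        · have : A σ j k = 0 := by
            by_contra hA
            exact hj (Relation.ReflTransGen.tail (not_not.1 hk) (hc.adj_of_entry_ne_zero hA))
          simp [this]
      · simp [hB, hj]
    have hBc : ContinuousOn (fun s => Matrix.of B *ᵥ y s) (Ici 0) :=
      (Continuous.matrix_mulVec continuous_const continuous_id).comp_continuousOn hyc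
    have hyeq : ∀ t, 0 ≤ t → y t = ∫ s in (0 : ℝ)..t, Matrix.of B *ᵥ y s := by
      intro t ht
      have hsub : uIcc 0 t ⊆ Ici 0 := by rw [uIcc_of_le ht]; exact Icc_subset_Ici_self
      funext j
      have := (ContinuousLinearMap.proj (R := ℝ) (φ := fun _ : Fin n => ℝ)
        j).intervalIntegral_comp_comm (μ := volume) (hBc.mono hsub).intervalIntegrable
      refine Eq.trans ?_ this
      simp only [ContinuousLinearMap.proj_apply, hBy]
      by_cases hj : j ∈ S
      · simp only [hy, hj, if_true]
        rw [hx.component_eq hu σ ht j]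
        simp
      · simp [hy, hj]
    have := congrFun (eq_zero_of_eq_integral_mulVec B hyc hyeq zero_le_one) i
    have hiS : i ∈ S := hi
    simpa [hy, hiS] using this
  have h1 := congrFun htarget i
  rw [integral_apply_of_integrable hint] at h1
  simp [key] at h1

end NecessityRoot

/-! ### Necessity of the spanning path of the core -/

section NecessityCore

variable {M : Type*} [TopologicalSpace M] {n : ℕ} {G : Digraph (Fin n ⊕ Unit)}
  {A : M →ᵇ (Fin n → Fin n → ℝ)} {b : M →ᵇ (Fin n → ℝ)}

/-- A nonzero entry of `A ^ k b` at a core node comes from a walk of `k + 1` edges from the input,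
and this walk stays in the core. The list runs from the end of the walk to its start. -/
lemma exists_chain_of_krylov_ne_zero (hG : IsSparsityPattern G) (hc : IsCompliant G A b) {σ : M} :
    ∀ (k : ℕ) (i : Fin n) (hi : Sum.inl i ∈ (cycSuccessors G)ᶜ), krylov A b k σ i ≠ 0 →
      ∃ l : List ↥(cycSuccessors G)ᶜ, l.length = k + 1 ∧
        (⟨Sum.inl i, hi⟩ :: l).IsChain fun v w => (core G).Adj w v := by
  intro k
  induction k with
  | zero =>
    intro i hi h
    rw [krylov_zero] at h
    exact ⟨[⟨inputNode n, hG.inputNode_mem_core⟩], rfl, by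
      simpa [core_adj] using hc.adj_of_input_ne_zero h⟩
  | succ k ih =>
    intro i hi h
    rw [krylov_succ_apply] at h
    obtain ⟨j, -, hj⟩ := Finset.exists_ne_zero_of_sum_ne_zero h
    have hadj := hc.adj_of_entry_ne_zero (left_ne_zero_of_mul hj)
    have hjC : Sum.inl j ∈ (cycSuccessors G)ᶜ := fun h' => hi (cycSuccessors_of_adj hadj h')
    obtain ⟨l, hl, hchain⟩ := ih j hjC (right_ne_zero_of_mul hj)
    exact ⟨⟨Sum.inl j, hjC⟩ :: l, by simp [hl], List.isChain_cons_cons.2 ⟨hadj, hchain⟩⟩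

/-- The iterated integrals of the input. -/
noncomputable def iteratedIntegral (u : ℝ → ℝ) : ℕ → ℝ → ℝ
  | 0 => u
  | k + 1 => fun t => ∫ s in (0 : ℝ)..t, iteratedIntegral u k s

lemma iteratedIntegral_intervalIntegrable {u : ℝ → ℝ} (hu : IsAdmissible u) (k : ℕ) :
    ∀ {t : ℝ}, 0 ≤ t → IntervalIntegrable (iteratedIntegral u k) volume 0 t := by
  induction k with
  | zero => exact hu.intervalIntegrable
  | succ k ih =>
    intro t ht
    exact (intervalIntegral.continuousOn_primitive_interval' (ih ht)
      left_mem_uIcc).intervalIntegrable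

/-- On the core the state operator is nilpotent, so that from a zero initial profile the states of
core nodes are finite combinations of the profiles `A ^ k b`, with coefficients depending on
time only. -/
lemma IsSolution.core_eq {u : ℝ → ℝ} {x : ℝ → M → (Fin n → ℝ)} (hc : IsCompliant G A b)
    (hu : IsAdmissible u) (hx : IsSolution A b u 0 x) {K : ℕ}
    (hK : ∀ σ i, Sum.inl i ∈ (cycSuccessors G)ᶜ → krylov A b K σ i = 0) (σ : M)
    (v : ↥(cycSuccessors G)ᶜ) : ∀ i : Fin n, (v : Fin n ⊕ Unit) = Sum.inl i → ∀ t, 0 ≤ t →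
      x t σ i = ∑ k ∈ Finset.range K, krylov A b k σ i * iteratedIntegral u (k + 1) t := by
  induction v using (core_wellFounded (G := G)).induction with
  | _ v ih =>
  intro i hvi t ht
  have hiC : Sum.inl i ∈ (cycSuccessors G)ᶜ := hvi ▸ v.2
  have hcoef : ∀ k, IntervalIntegrable (iteratedIntegral u k) volume 0 t :=
    fun k => iteratedIntegral_intervalIntegrable hu k ht
  have hrhs : ∀ s ∈ uIcc 0 t, (∑ j, A σ i j * x s σ j) + u s * b σ i =
      ∑ k ∈ Finset.range K, krylov A b k σ i * iteratedIntegral u k s := by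
    intro s hs
    rw [uIcc_of_le ht] at hs
    have h1 : ∑ j, A σ i j * x s σ j =
        ∑ k ∈ Finset.range K, krylov A b (k + 1) σ i * iteratedIntegral u (k + 1) s := by
      simp only [krylov_succ_apply, Finset.sum_mul]
      rw [Finset.sum_comm]
      refine Finset.sum_congr rfl fun j _ => ?_
      by_cases hA : A σ i j = 0
      · simp [hA]
      have hadj := hc.adj_of_entry_ne_zero hA
      have hjC : Sum.inl j ∈ (cycSuccessors G)ᶜ := fun h' => hiC (cycSuccessors_of_adj hadj h')
      rw [ih ⟨Sum.inl j, hjC⟩ (by rw [core_adj, hvi]; exact hadj) j rfl s hs.1, Finset.mul_sum]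
      exact Finset.sum_congr rfl fun k _ => by ring
    have h2 := Finset.sum_range_succ (fun k => krylov A b k σ i * iteratedIntegral u k s) K
    rw [Finset.sum_range_succ', hK σ i hiC, zero_mul, add_zero] at h2
    rw [h1, ← h2, krylov_zero]
    simp [iteratedIntegral, mul_comm]
  rw [hx.component_eq hu σ ht i, intervalIntegral.integral_congr hrhs,
    intervalIntegral.integral_finsetSum fun k _ => (hcoef k).const_mul _]
  simp [iteratedIntegral]

variable [MeasurableSpace M] [BorelSpace M] {μ : Measure M} [IsFiniteMeasure μ]

/-- Without a spanning path in the core, `A ^ k b` vanishes on the core for all `k` from the number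
of core states minus one on, so that the reachable averages of the core states lie in a space
of smaller dimension than the number of these states. -/
lemma core_hasDirectedSpanningPath_of_isAveragedControllable (hG : IsSparsityPattern G)
    (hc : IsCompliant G A b) (h : IsAveragedControllable μ A b) :
    HasDirectedSpanningPath (core G) := by
  classical
  by_contra hns
  let C : Type := {i : Fin n // Sum.inl i ∈ (cycSuccessors G)ᶜ}
  have hβ := hG.inputNode_mem_core
  have hcard : Nat.card ↥(cycSuccessors G)ᶜ = Fintype.card C + 1 := by
    let e : Option C ≃ ↥(cycSuccessors G)ᶜ :=
      { toFun := fun o => o.elim ⟨inputNode n, hβ⟩ fun i => ⟨Sum.inl i.1, i.2⟩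
        invFun := fun v => match v with
          | ⟨Sum.inl i, hi⟩ => some ⟨i, hi⟩
          | ⟨Sum.inr _, _⟩ => none
        left_inv := fun o => by cases o <;> rfl
        right_inv := fun v => by rcases v with ⟨_ | _, _⟩ <;> rfl }
    rw [← Nat.card_congr e, Nat.card_eq_fintype_card, Fintype.card_option]
  have hpos : 0 < Fintype.card C := by
    by_contra h0
    refine hns (core_hasDirectedSpanningPath_of_chain (l := [⟨inputNode n, hβ⟩])
      (List.isChain_singleton _) (by simp) ?_)
    simp only [List.length_singleton]
    omega
  obtain ⟨K, hKC⟩ : ∃ K, Fintype.card C = K + 1 := ⟨_, (Nat.succ_pred_eq_of_pos hpos).symm⟩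
  have hK : ∀ σ i, Sum.inl i ∈ (cycSuccessors G)ᶜ → krylov A b K σ i = 0 := by
    intro σ i hi
    by_contra hne
    obtain ⟨l, hl, hchain⟩ := exists_chain_of_krylov_ne_zero hG hc K i hi hne
    refine hns (core_hasDirectedSpanningPath_of_chain hchain (by simp) ?_)
    rw [hcard, hKC, List.length_cons, hl]
  let F : (Fin K → ℝ) →ₗ[ℝ] (C → ℝ) :=
    (Matrix.of fun (i : C) (k : Fin K) => ∫ σ, krylov A b k σ i.1 ∂μ).mulVecLin
  have hsurj : Function.Surjective F := by
    intro c
    obtain ⟨u, hu, x, hx, hint, htarget⟩ := h 0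
      (fun i => if hi : Sum.inl i ∈ (cycSuccessors G)ᶜ then c ⟨i, hi⟩ else 0) 1 one_pos
    refine ⟨fun k => iteratedIntegral u (k + 1) 1, ?_⟩
    funext i
    have h1 := congrFun htarget i.1
    rw [integral_apply_of_integrable hint, dif_pos i.2] at h1
    refine Eq.trans ?_ h1
    have h2 : ∀ σ, x 1 σ i.1 =
        ∑ k ∈ Finset.range K, krylov A b k σ i.1 * iteratedIntegral u (k + 1) 1 := fun σ =>
      hx.core_eq hc hu hK σ ⟨Sum.inl i.1, i.2⟩ i.1 rfl 1 zero_le_one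
    simp only [h2]
    rw [integral_finsetSum _ fun k _ =>
      (((krylov A b k).integrable μ).eval i.1).mul_const _]
    simp only [integral_mul_const]
    exact (Fin.sum_univ_eq_sum_range (fun k => (∫ σ, krylov A b k σ i.1 ∂μ) *
      iteratedIntegral u (k + 1) 1) K)
  have := LinearMap.finrank_le_finrank_of_surjective hsurj
  simp only [Module.finrank_fintype_fun_eq_card, Fintype.card_fin, hKC] at this
  omega

end NecessityCore

/-! ### A rank criterion for averaged controllability -/

section Exponential

variable {X : Type*} [NormedAddCommGroup X] [NormedSpace ℝ X]

/-- The semigroup `exp (t L)` of a bounded operator. -/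
noncomputable def flow (L : X →L[ℝ] X) (t : ℝ) : X →L[ℝ] X := NormedSpace.exp (t • L)

lemma flow_zero (L : X →L[ℝ] X) : flow L 0 = 1 := by simp [flow]

variable [CompleteSpace X]

lemma hasDerivAt_flow (L : X →L[ℝ] X) (t : ℝ) : HasDerivAt (flow L) (L * flow L t) t :=
  hasDerivAt_exp_smul_const' L t


lemma flow_mul_flow_neg (L : X →L[ℝ] X) (t : ℝ) : flow L t * flow L (-t) = 1 := by
  let _ : NormedAlgebra ℚ (X →L[ℝ] X) := NormedAlgebra.restrictScalars ℚ ℝ _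
  rw [flow, flow, ← NormedSpace.exp_add_of_commute]
  · simp
  · exact ((Commute.refl L).smul_left t).smul_right (-t)

lemma flow_mul_comm (L : X →L[ℝ] X) (t : ℝ) : L * flow L t = flow L t * L :=
  (hasDerivAt_flow L t).unique (hasDerivAt_exp_smul_const L t)

lemma continuous_flow (L : X →L[ℝ] X) : Continuous (flow L) :=
  continuous_iff_continuousAt.2 fun t => (hasDerivAt_flow L t).continuousAt

lemma continuous_flow_neg_apply (L : X →L[ℝ] X) (v : X) : Continuous fun s => flow L (-s) v :=
  ((continuous_flow L).comp continuous_neg).clm_apply continuous_const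

lemma flow_flow_neg_apply (L : X →L[ℝ] X) (t : ℝ) (v : X) : flow L t (flow L (-t) v) = v :=
  congrArg (fun S : X →L[ℝ] X => S v) (flow_mul_flow_neg L t)

/-- Variation of constants for `z' = L z + u(t) v`, `z(0) = z₀`. -/
noncomputable def variationOfConstants (L : X →L[ℝ] X) (v z₀ : X) (u : ℝ → ℝ) (t : ℝ) : X :=
  flow L t (z₀ + ∫ s in (0 : ℝ)..t, u s • flow L (-s) v)

lemma hasDerivAt_variationOfConstants (L : X →L[ℝ] X) (v z₀ : X) {u : ℝ → ℝ} (hu : Continuous u)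
    (t : ℝ) : HasDerivAt (variationOfConstants L v z₀ u)
      (L (variationOfConstants L v z₀ u t) + u t • v) t := by
  have hc : Continuous fun s => u s • flow L (-s) v := hu.smul (continuous_flow_neg_apply L v)
  have h := (hasDerivAt_flow L t).clm_apply
    (((hc.integral_hasStrictDerivAt 0 t).hasDerivAt).const_add z₀)
  rw [map_smul, flow_flow_neg_apply] at h
  exact h

/-- If a continuous functional `ψ` annihilates the reachable set of `z' = L z + u v` at a time
`T > 0`, it annihilates all `L ^ k v`. -/
lemma apply_pow_eq_zero_of_apply_reachable_eq_zero (L : X →L[ℝ] X) (v : X) (ψ : X →L[ℝ] ℝ) {T : ℝ}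
    (hT : 0 < T)
    (h : ∀ u : ℝ → ℝ, Continuous u →
      ψ (flow L T (∫ s in (0 : ℝ)..T, u s • flow L (-s) v)) = 0) (k : ℕ) :
    ψ ((L ^ k) v) = 0 := by
  set g : ℕ → ℝ → ℝ := fun k s => ψ (flow L T (flow L (-s) ((L ^ k) v))) with hg
  have hgc : ∀ k, Continuous (g k) := fun k =>
    ψ.continuous.comp ((flow L T).continuous.comp (continuous_flow_neg_apply L _))
  have hder : ∀ k s, HasDerivAt (g k) (-g (k + 1) s) s := by
    intro k s
    have h1 : HasDerivAt (fun s => flow L (-s)) (-(L * flow L (-s))) s := by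
      have := (hasDerivAt_flow L (-s)).scomp s (hasDerivAt_neg s)
      rw [neg_one_smul] at this
      exact this
    have h2 := (ψ.comp (flow L T)).hasFDerivAt.comp_hasDerivAt s
      (h1.clm_apply (hasDerivAt_const s ((L ^ k) v)))
    refine h2.congr_deriv ?_
    simp only [hg, flow_mul_comm, pow_succ']
    simp
  -- The test input `u = g 0` turns the hypothesis into a vanishing integral of a square.
  have h0 : ∀ s ∈ Icc 0 T, g 0 s = 0 := by
    by_contra! hne
    obtain ⟨s, hs, hs0⟩ := hne
    have hint : IntervalIntegrable (fun s => g 0 s • flow L (-s) v) volume 0 T :=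
      ((hgc 0).smul (continuous_flow_neg_apply L v)).intervalIntegrable _ _
    have h1 := (ψ.comp (flow L T)).intervalIntegral_comp_comm hint
    have h2 : (ψ.comp (flow L T)) (∫ s in (0 : ℝ)..T, g 0 s • flow L (-s) v) = 0 := h (g 0) (hgc 0)
    rw [h2] at h1
    refine absurd h1 (ne_of_gt ?_)
    have h3 : ∀ s, (ψ.comp (flow L T)) (g 0 s • flow L (-s) v) = g 0 s * g 0 s := by
      intro s; simp [hg]
    simp only [h3]
    exact intervalIntegral.integral_pos hT ((hgc 0).mul (hgc 0)).continuousOn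
      (fun s _ => mul_self_nonneg _) ⟨s, hs, mul_self_pos.2 hs0⟩
  have hk : ∀ k, ∀ s ∈ Ioo 0 T, g k s = 0 := by
    intro k
    induction k with
    | zero => exact fun s hs => h0 s ⟨hs.1.le, hs.2.le⟩
    | succ k ih =>
      intro s hs
      have : g k =ᶠ[nhds s] fun _ => 0 := by
        filter_upwards [Ioo_mem_nhds hs.1 hs.2] with r hr using ih r hr
      have := ((hder k s).congr_of_eventuallyEq this.symm).unique (hasDerivAt_const s 0)
      linarith
  have hcl : g k T = 0 := by
    have hmem : T ∈ closure (Ioo 0 T) := by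
      rw [closure_Ioo hT.ne]; exact ⟨hT.le, le_rfl⟩
    exact (isClosed_singleton.preimage (hgc k)).closure_subset_iff.2 (hk k) hmem
  simp only [hg, flow_flow_neg_apply] at hcl
  exact hcl

end Exponential

section RankCriterion

variable {M : Type*} [TopologicalSpace M] {n : ℕ}

lemma isSolution_variationOfConstants (A : M →ᵇ (Fin n → Fin n → ℝ)) (b x₀ : M →ᵇ (Fin n → ℝ))
    {u : ℝ → ℝ} (hu : Continuous u) :
    IsSolution A b u x₀ fun t σ => variationOfConstants (stateOp A) b x₀ u t σ := by
  have hder : ∀ σ t, HasDerivAt (fun t => variationOfConstants (stateOp A) b x₀ u t σ)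
      (Matrix.of (A σ) *ᵥ variationOfConstants (stateOp A) b x₀ u t σ + u t • b σ) t :=
    fun σ t => ((BoundedContinuousFunction.evalCLM ℝ σ :
      (M →ᵇ (Fin n → ℝ)) →L[ℝ] (Fin n → ℝ)).hasFDerivAt (x :=
        variationOfConstants (stateOp A) b x₀ u t)).comp_hasDerivAt t
      (hasDerivAt_variationOfConstants (stateOp A) b x₀ hu t)
  have hcont : ∀ σ, Continuous fun t => variationOfConstants (stateOp A) b x₀ u t σ :=
    fun σ => continuous_iff_continuousAt.2 fun t => (hder σ t).continuousAt
  refine ⟨fun σ => (hcont σ).continuousOn, fun σ t _ => ?_⟩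
  rw [intervalIntegral.integral_eq_sub_of_hasDerivAt (fun s _ => hder σ s)
    (((Continuous.matrix_mulVec continuous_const (hcont σ)).add
      (hu.smul continuous_const)).intervalIntegrable _ _)]
  simp [variationOfConstants, flow_zero]

variable [MeasurableSpace M] [BorelSpace M] (μ : Measure M) [IsProbabilityMeasure μ]

/-- The average of a bounded continuous profile. -/
noncomputable def average : (M →ᵇ (Fin n → ℝ)) →L[ℝ] (Fin n → ℝ) :=
  LinearMap.mkContinuous
    { toFun := fun x => ∫ σ, x σ ∂μ
      map_add' := fun x y => integral_add (x.integrable μ) (y.integrable μ)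
      map_smul' := fun c x => integral_smul c _ }
    1 (fun x => by
      rw [one_mul]
      exact x.norm_integral_le_norm μ)

lemma average_apply (x : M →ᵇ (Fin n → ℝ)) : average μ x = ∫ σ, x σ ∂μ := rfl

/-- The Kalman criterion for the average: a pair is averaged controllable as soon as the averages
of the profiles `A ^ k b` span the state space. -/
lemma isAveragedControllable_of_krylov {A : M →ᵇ (Fin n → Fin n → ℝ)} {b : M →ᵇ (Fin n → ℝ)}
    (h : ∀ c : Fin n → ℝ, (∀ k, ∑ i, c i * ∫ σ, krylov A b k σ i ∂μ = 0) → c = 0) :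
    IsAveragedControllable μ A b := by
  classical
  intro x₀ target T hT
  set L := stateOp A
  have hint : ∀ u : C(ℝ, ℝ), IntervalIntegrable (fun s => u s • flow L (-s) b) volume 0 T :=
    fun u => (u.continuous.smul (continuous_flow_neg_apply L b)).intervalIntegrable _ _
  let F : C(ℝ, ℝ) →ₗ[ℝ] (Fin n → ℝ) :=
    { toFun := fun u => average μ (flow L T (∫ s in (0 : ℝ)..T, u s • flow L (-s) b))
      map_add' := fun u w => by
        have : ∀ s, (u + w) s • flow L (-s) b = u s • flow L (-s) b + w s • flow L (-s) b :=
          fun s => by ext; simp [add_mul]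
        simp only [this]
        rw [intervalIntegral.integral_add (hint u) (hint w), map_add, map_add]
      map_smul' := fun c u => by
        have : ∀ s, (c • u) s • flow L (-s) b = c • u s • flow L (-s) b :=
          fun s => smul_assoc c (u s) _
        simp only [this]
        rw [intervalIntegral.integral_smul, map_smul, map_smul, RingHom.id_apply] }
  have hF : LinearMap.range F = ⊤ := by
    by_contra hne
    obtain ⟨f, hf, hfker⟩ := Submodule.exists_le_ker_of_lt_top _ (lt_top_iff_ne_top.2 hne)
    have hfc : ∀ y, f y = ∑ i, f (Pi.single i 1) * y i := by
      intro y
      rw [LinearMap.pi_apply_eq_sum_univ f y]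
      refine Finset.sum_congr rfl fun i _ => ?_
      have hi : (fun j => if i = j then (1 : ℝ) else 0) = Pi.single i 1 := by
        funext j
        rw [Pi.single_apply]
        exact if_congr eq_comm rfl rfl
      rw [hi, smul_eq_mul, mul_comm]
    have hk := apply_pow_eq_zero_of_apply_reachable_eq_zero L b
      (f.toContinuousLinearMap.comp (average μ)) hT (fun u hu =>
        hfker (LinearMap.mem_range_self F ⟨u, hu⟩))
    have hc := h (fun i => f (Pi.single i 1)) fun k => by
      have hk' : f (average μ (krylov A b k)) = 0 := hk k
      rw [hfc, average_apply] at hk'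
      rw [← hk']
      refine Finset.sum_congr rfl fun i _ => ?_
      rw [integral_apply_of_integrable (BoundedContinuousFunction.integrable μ _)]
    refine hf (LinearMap.ext fun y => ?_)
    rw [hfc]
    simp only [funext_iff, Pi.zero_apply] at hc
    simp [hc]
  obtain ⟨u, hu⟩ := LinearMap.range_eq_top.1 hF (target - average μ (flow L T x₀))
  refine ⟨u, fun T _ => u.continuous.continuousOn.integrableOn_Icc, _,
    isSolution_variationOfConstants A b x₀ u.continuous,
    BoundedContinuousFunction.integrable μ _, ?_⟩
  have h1 : average μ (variationOfConstants L b x₀ u T) = target := by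
    rw [variationOfConstants, map_add, map_add]
    exact (congrArg _ hu).trans (by simp)
  exact h1

end RankCriterion

/-! ### A subgraph with eventually periodic numbers of walks -/

section WalkCount

variable {V : Type*} {G : Digraph V} {r : V}

/-- A rank (the distance from the root) that decreases along some edge into each node other than
the root. -/
lemma IsRoot.exists_rank (h : IsRoot G r) :
    ∃ ρ : V → ℕ, ∀ v, v ≠ r → ∃ u, G.Adj u v ∧ ρ u < ρ v := by
  let R : ℕ → Set V := fun k => Nat.rec {r} (fun _ S => {w | ∃ v ∈ S, G.Adj v w}) k
  have hR : ∀ v, ∃ k, v ∈ R k := by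
    intro v
    induction h v with
    | refl => exact ⟨0, rfl⟩
    | @tail b c _ hbc ih =>
      obtain ⟨k, hk⟩ := ih
      exact ⟨k + 1, b, hk, hbc⟩
  refine ⟨fun v => sInf {k | v ∈ R k}, fun v hv => ?_⟩
  have hs : v ∈ R (sInf {k | v ∈ R k}) := Nat.sInf_mem (hR v)
  rcases hk : sInf {k | v ∈ R k} with _ | k
  · rw [hk] at hs
    exact absurd hs hv
  · rw [hk] at hs
    obtain ⟨u, hu, huv⟩ := hs
    exact ⟨u, huv, (Nat.lt_succ_of_le (Nat.sInf_le hu)).trans_eq hk.symm⟩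

/-- The position of the core nodes on a spanning path of the core. -/
lemma HasDirectedSpanningPath.exists_position (h : HasDirectedSpanningPath (core G))
    (hr : ∀ v, ¬ G.Adj v r) (hrC : r ∈ (cycSuccessors G)ᶜ) :
    ∃ pos : V → ℕ, InjOn pos (cycSuccessors G)ᶜ ∧ pos r = 0 ∧
      ∀ v ∈ (cycSuccessors G)ᶜ, v ≠ r →
        ∃ u ∈ (cycSuccessors G)ᶜ, G.Adj u v ∧ pos v = pos u + 1 := by
  classical
  obtain ⟨l, -, hnd, hchain, hmem⟩ := h
  let pos : V → ℕ := fun v => if hv : v ∈ (cycSuccessors G)ᶜ then l.idxOf ⟨v, hv⟩ else 0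
  have hpos : ∀ v : ↥(cycSuccessors G)ᶜ, pos v = l.idxOf v := fun v => dif_pos v.2
  have hpred : ∀ v : ↥(cycSuccessors G)ᶜ, pos v ≠ 0 →
      ∃ u : ↥(cycSuccessors G)ᶜ, G.Adj u v ∧ pos v = pos u + 1 := by
    intro v hv
    obtain ⟨k, hk⟩ := Nat.exists_eq_succ_of_ne_zero hv
    rw [hpos] at hk
    have hlt : k + 1 < l.length := by
      have := List.idxOf_lt_length_of_mem (hmem v)
      omega
    have hadj := List.isChain_iff_getElem.1 hchain k hlt
    have hv' : l[k + 1] = v := by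
      have := List.getElem_idxOf (List.idxOf_lt_length_of_mem (hmem v))
      simpa [hk] using this
    rw [hv', core_adj] at hadj
    refine ⟨l[k], hadj, ?_⟩
    rw [hpos, hpos, hk, hnd.idxOf_getElem]
  have hr0 : pos r = 0 := by
    by_contra h0
    obtain ⟨u, hu, -⟩ := hpred ⟨r, hrC⟩ h0
    exact hr u hu
  have hinj : InjOn pos (cycSuccessors G)ᶜ := by
    intro v hv w hw hvw
    have h1 := hpos ⟨v, hv⟩
    have h2 := hpos ⟨w, hw⟩
    have h3 : l.idxOf ⟨v, hv⟩ = l.idxOf ⟨w, hw⟩ := by rw [← h1, ← h2]; exact hvw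
    exact congrArg Subtype.val ((List.idxOf_inj (hmem _)).1 h3)
  refine ⟨pos, hinj, hr0, fun v hv hvr => ?_⟩
  obtain ⟨u, hu, huv⟩ := hpred ⟨v, hv⟩ fun h0 => hvr (hinj hv hrC (h0.trans hr0.symm))
  exact ⟨u, u.2, hu, huv⟩

variable [Fintype V]

open scoped Classical in
/-- The number of walks with `k` edges from `r` to a node, in the digraph with adjacency `H`. -/
noncomputable def walkCount (H : V → V → Prop) (r : V) : ℕ → V → ℝ
  | 0 => fun v => if v = r then 1 else 0
  | k + 1 => fun v => ∑ u, if H u v then walkCount H r k u else 0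

open scoped Classical in
lemma walkCount_succ (H : V → V → Prop) (r : V) (k : ℕ) (v : V) :
    walkCount H r (k + 1) v = ∑ u, if H u v then walkCount H r k u else 0 := rfl

lemma walkCount_nonneg (H : V → V → Prop) (r : V) (k : ℕ) (v : V) : 0 ≤ walkCount H r k v := by
  induction k generalizing v with
  | zero => simp only [walkCount]; split_ifs <;> norm_num
  | succ k ih =>
    refine Finset.sum_nonneg fun u _ => ?_
    split_ifs
    · exact ih u
    · exact le_rfl

lemma walkCount_pos_of_adj {H : V → V → Prop} {k : ℕ} {u v : V} (huv : H u v)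
    (hu : 0 < walkCount H r k u) : 0 < walkCount H r (k + 1) v := by
  classical
  refine Finset.sum_pos' (fun w _ => ?_) ⟨u, Finset.mem_univ u, by simpa [huv] using hu⟩
  split_ifs
  · exact walkCount_nonneg H r k w
  · exact le_rfl

lemma walkCount_succ_eq {H : V → V → Prop} {k : ℕ} {u v : V} (huv : H u v)
    (h : ∀ w, H w v → w ≠ u → walkCount H r k w = 0) :
    walkCount H r (k + 1) v = walkCount H r k u := by
  classical
  refine (Finset.sum_eq_single u (fun w _ hw => ?_) (by simp)).trans (if_pos huv)
  split_ifs with hwv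
  · exact h w hwv hw
  · rfl

/-- A digraph with root `r` whose core has a spanning path contains a subgraph in which the numbers
of walks from `r` are eventually periodic in the length, do not die out at the successors of
cycles, and separate the core nodes. The subgraph consists of the path in the core, all edges
leaving the core, and one edge `parent v → v` for each successor `v` of a cycle, so that beyond the
length of the path the numbers are transported by the map `parent`. -/
theorem exists_subgraph_walkCount (hr : ∀ v, ¬ G.Adj v r) (hrC : r ∈ (cycSuccessors G)ᶜ)
    (hroot : IsRoot G r) (hspan : HasDirectedSpanningPath (core G)) :
    ∃ H : V → V → Prop, (∀ u v, H u v → G.Adj u v) ∧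
      (∃ P K, 0 < P ∧ ∀ k, K ≤ k → ∀ v, walkCount H r (k + P) v = walkCount H r k v) ∧
      (∀ v ∈ cycSuccessors G, ∀ m, ∃ k, m ≤ k ∧ walkCount H r k v ≠ 0) ∧
      (∀ v ∈ (cycSuccessors G)ᶜ, ∃ k, walkCount H r k v ≠ 0 ∧
        ∀ u ∈ (cycSuccessors G)ᶜ, u ≠ v → walkCount H r k u = 0) := by
  classical
  obtain ⟨ρ, hρ⟩ := hroot.exists_rank
  obtain ⟨pos, hinj, hpos0, hpos⟩ := hspan.exists_position hr hrC
  -- A node without an edge from the core takes a parent that is closer to the root, so that every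
  -- orbit of `parent` meets nodes entered from the core again and again.
  have hparent : ∀ v ∈ cycSuccessors G, ∃ u ∈ cycSuccessors G, G.Adj u v ∧
      ((∃ w ∈ (cycSuccessors G)ᶜ, G.Adj w v) ∨ ρ u < ρ v) := by
    intro v hv
    by_cases hw : ∃ w ∈ (cycSuccessors G)ᶜ, G.Adj w v
    · obtain ⟨u, hu, huv⟩ := exists_adj_of_mem_cycSuccessors hv
      exact ⟨u, hu, huv, Or.inl hw⟩
    · obtain ⟨u, huv, hlt⟩ := hρ v (by rintro rfl; exact hrC hv)
      refine ⟨u, ?_, huv, Or.inr hlt⟩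
      by_contra hu
      exact hw ⟨u, hu, huv⟩
  choose! parent hpar_mem hpar_adj hpar using hparent
  let H : V → V → Prop := fun u v => G.Adj u v ∧
    ((v ∈ (cycSuccessors G)ᶜ ∧ pos v = pos u + 1) ∨
      (v ∈ cycSuccessors G ∧ (u ∈ (cycSuccessors G)ᶜ ∨ u = parent v)))
  have hcore : ∀ k, ∀ v ∈ (cycSuccessors G)ᶜ,
      walkCount H r k v = if pos v = k then 1 else 0 := by
    intro k
    induction k with
    | zero =>
      intro v hv
      have : v = r ↔ pos v = 0 :=
        ⟨fun h => h ▸ hpos0, fun h => hinj hv hrC (h.trans hpos0.symm)⟩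
      simp only [walkCount, this]
    | succ k ih =>
      intro v hv
      have hpredC : ∀ w, H w v → w ∈ (cycSuccessors G)ᶜ ∧ pos v = pos w + 1 := by
        rintro w ⟨hadj, h | h⟩
        · exact ⟨fun hw => hv (cycSuccessors_of_adj hadj hw), h.2⟩
        · exact absurd h.1 hv
      by_cases hvr : v = r
      · rw [hvr, hpos0, if_neg (Nat.succ_ne_zero k).symm]
        exact Finset.sum_eq_zero fun u _ => if_neg fun hu => hr u hu.1
      · obtain ⟨u, hu, huv, hpuv⟩ := hpos v hv hvr
        rw [walkCount_succ_eq (u := u) ⟨huv, Or.inl ⟨hv, hpuv⟩⟩, ih u hu, hpuv]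
        · simp
        · intro w hw hwu
          have := hpredC w hw
          exact absurd (hinj this.1 hu (by omega)) hwu
  obtain ⟨K, hK⟩ : ∃ K, ∀ v, pos v < K :=
    ⟨Finset.univ.sup pos + 1, fun v => Nat.lt_succ_of_le (Finset.le_sup (Finset.mem_univ v))⟩
  have hcore0 : ∀ k, K ≤ k → ∀ v ∈ (cycSuccessors G)ᶜ, walkCount H r k v = 0 := by
    intro k hk v hv
    rw [hcore k v hv, if_neg]
    have := hK v
    omega
  have hH : ∀ v ∈ cycSuccessors G, H (parent v) v := fun v hv =>
    ⟨hpar_adj v hv, Or.inr ⟨hv, Or.inr rfl⟩⟩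
  have htransport : ∀ j, ∀ v ∈ cycSuccessors G,
      walkCount H r (K + j) v = walkCount H r K (parent^[j] v) := by
    intro j
    induction j with
    | zero => exact fun v _ => rfl
    | succ j ih =>
      intro v hv
      rw [Function.iterate_succ_apply, ← ih _ (hpar_mem v hv)]
      refine walkCount_succ_eq (hH v hv) fun w hw hwp => ?_
      rcases hw.2 with h | h
      · exact absurd hv h.1
      · exact hcore0 _ (Nat.le_add_right K j) w (h.2.resolve_right hwp)
  refine ⟨H, fun u v h => h.1, ?_, ?_, ?_⟩
  · obtain ⟨a, b, hab, heq⟩ :=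
      Finite.exists_ne_map_eq_of_infinite fun j : ℕ => (parent^[j] : V → V)
    wlog hlt : a < b generalizing a b
    · exact this b a hab.symm heq.symm (by omega)
    refine ⟨b - a, K + a, by omega, fun k hk v => ?_⟩
    by_cases hv : v ∈ cycSuccessors G
    · obtain ⟨t, rfl⟩ := Nat.exists_eq_add_of_le hk
      have h1 : K + a + t + (b - a) = K + (t + b) := by omega
      have h2 : K + a + t = K + (t + a) := by omega
      rw [h1, h2, htransport _ v hv, htransport _ v hv, Function.iterate_add_apply,
        Function.iterate_add_apply]
      exact congrArg (fun f : V → V => walkCount H r K (parent^[t] (f v))) heq.symm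
    · rw [hcore0 _ (by omega) v hv, hcore0 _ (by omega) v hv]
  · suffices h : ∀ m, ∀ v ∈ cycSuccessors G, ∃ k, m ≤ k ∧ 0 < walkCount H r k v from
      fun v hv m => (h m v hv).imp fun k hk => ⟨hk.1, hk.2.ne'⟩
    intro m
    induction m with
    | zero =>
      intro v
      induction hd : ρ v using Nat.strong_induction_on generalizing v with
      | _ d ih =>
        intro hv
        rcases hpar v hv with ⟨w, hw, hwv⟩ | hlt
        · refine ⟨pos w + 1, Nat.zero_le _, walkCount_pos_of_adj (u := w)
            ⟨hwv, Or.inr ⟨hv, Or.inl hw⟩⟩ ?_⟩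
          simp [hcore _ w hw]
        · obtain ⟨k, -, hk⟩ := ih _ (hd ▸ hlt) (parent v) rfl (hpar_mem v hv)
          exact ⟨k + 1, Nat.zero_le _, walkCount_pos_of_adj (hH v hv) hk⟩
    | succ m ih =>
      intro v hv
      obtain ⟨k, hmk, hk⟩ := ih _ (hpar_mem v hv)
      exact ⟨k + 1, by omega, walkCount_pos_of_adj (hH v hv) hk⟩
  · intro v hv
    refine ⟨pos v, by simp [hcore _ v hv], fun u hu huv => ?_⟩
    rw [hcore _ u hu, if_neg fun h => huv (hinj hu hv h)]

end WalkCount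

/-! ### A continuous function with infinitely many values on an open set of a manifold -/

section Manifold

variable {E : Type*} [NormedAddCommGroup E] [NormedSpace ℝ E] {H : Type*} [TopologicalSpace H]
  {M : Type*} [TopologicalSpace M] [ChartedSpace H M]

lemma not_isOpen_singleton_of_nontrivial [Nontrivial E] (I : ModelWithCorners ℝ E H) (x : M) :
    ¬ IsOpen ({x} : Set M) := by
  intro hx
  have hopen := (chartAt H x).isOpen_image_of_subset_source hx
    (singleton_subset_iff.2 (mem_chart_source H x))
  rw [image_singleton] at hopen
  obtain ⟨W, hW, hWx⟩ := I.isClosedEmbedding.isInducing.isOpen_iff.1 hopen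
  have hnt : (range I).Nontrivial := by
    obtain ⟨y, hy⟩ := I.nonempty_interior
    have : (nhdsWithin y {y}ᶜ).NeBot := Module.punctured_nhds_neBot ℝ E y
    exact (infinite_of_mem_nhds y (mem_interior_iff_mem_nhds.1 hy)).nontrivial
  have hmem : I (chartAt H x x) ∈ W := by
    have : chartAt H x x ∈ I ⁻¹' W := by rw [hWx]; rfl
    exact this
  obtain ⟨y, ⟨hyW, z, rfl⟩, hne⟩ := accPt_iff_nhds.1
    ((I.convex_range.isPreconnected.preperfect_of_nontrivial hnt) _ (mem_range_self _)) W
    (hW.mem_nhds hmem)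
  have hz : z ∈ I ⁻¹' W := hyW
  rw [hWx] at hz
  exact hne (congrArg I hz)

/-- A nonempty open subset of a manifold of positive dimension carries continuous functions with
infinitely many values; the range `[1, 2]` keeps all integer powers bounded. -/
lemma exists_continuousMap_infinite_image [FiniteDimensional ℝ E] [Nontrivial E]
    (I : ModelWithCorners ℝ E H) [T2Space M] [SecondCountableTopology M]
    {U : Set M} (hU : IsOpen U) (hne : U.Nonempty) :
    ∃ φ : C(M, Icc (1 : ℝ) 2), (φ '' U).Infinite := by
  have := Manifold.locallyCompact_of_finiteDimensional (M := M) I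
  have := TopologicalSpace.metrizableSpace_of_t3_secondCountable M
  let _ := TopologicalSpace.metrizableSpaceMetric M
  obtain ⟨x, hx⟩ := hne
  let f : M → ℝ := fun y => 1 + min 1 (dist y x)
  have hf : Continuous f := by fun_prop
  have hmem : ∀ y, f y ∈ Icc (1 : ℝ) 2 := fun y =>
    ⟨le_add_of_nonneg_right (le_min zero_le_one dist_nonneg), by
      have := min_le_left 1 (dist y x)
      simp only [f]
      linarith⟩
  refine ⟨⟨fun y => ⟨f y, hmem y⟩, hf.subtype_mk _⟩, fun hfin => ?_⟩
  have hfin' : (f '' U).Finite := by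
    refine (hfin.image Subtype.val).subset ?_
    rintro _ ⟨y, hy, rfl⟩
    exact ⟨_, ⟨y, hy, rfl⟩, rfl⟩
  -- With finitely many values, `x` would be isolated, being the only zero of the distance to it.
  refine not_isOpen_singleton_of_nontrivial I x ?_
  have h1 : ({x} : Set M) = U ∩ f ⁻¹' (f '' U \ {1})ᶜ := by
    ext y
    constructor
    · rintro rfl
      exact ⟨hx, by simp [f]⟩
    · rintro ⟨hyU, hy⟩
      have hy1 : f y = 1 := by
        by_contra h
        exact hy ⟨⟨y, hyU, rfl⟩, h⟩
      have : min 1 (dist y x) = 0 := by simpa [f] using hy1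
      rcases min_choice 1 (dist y x) with h | h
      · rw [h] at this; norm_num at this
      · exact dist_eq_zero.1 (h.symm.trans this)
  rw [h1]
  exact hU.inter (((hfin'.subset sdiff_subset).isClosed).isOpen_compl.preimage hf)

end Manifold

/-! ### Moments along an arithmetic progression -/

section Moments

variable {M : Type*} [TopologicalSpace M] [MeasurableSpace M] [BorelSpace M] {μ : Measure M}
  [IsFiniteMeasure μ]

lemma integrable_comp_continuousMap (φ : C(M, Icc (1 : ℝ) 2)) {g : ℝ → ℝ} (hg : Continuous g) :
    Integrable (fun σ => g (φ σ)) μ :=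
  ((BoundedContinuousFunction.mkOfCompact
    ⟨fun t : Icc (1 : ℝ) 2 => g t, by fun_prop⟩).compContinuous φ).integrable μ

/-- A polynomial in `φ ^ P` is determined by its moments along an arithmetic progression of
difference `P`: these moments determine the integral of `φ ^ k` times its square. -/
lemma polynomial_eq_zero_of_moments (φ : C(M, Icc (1 : ℝ) 2)) {U : Set M}
    (hU : U ⊆ μ.support) (hφ : (φ '' U).Infinite) (k : ℕ) {P : ℕ} (hP : 0 < P)
    (Q : Polynomial ℝ)
    (h : ∀ q, ∫ σ, (φ σ : ℝ) ^ (k + P * q) * Q.eval ((φ σ : ℝ) ^ P) ∂μ = 0) : Q = 0 := by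
  let g : ℝ → ℝ := fun t => t ^ k * Q.eval (t ^ P) ^ 2
  have hg : Continuous g := by fun_prop
  have hg0 : ∀ σ, 0 ≤ g (φ σ) := fun σ =>
    mul_nonneg (pow_nonneg (zero_le_one.trans (φ σ).2.1) _) (sq_nonneg _)
  have hint : ∫ σ, g (φ σ) ∂μ = 0 := by
    have h1 : ∀ σ, g (φ σ) = ∑ q ∈ Finset.range (Q.natDegree + 1),
        Q.coeff q * ((φ σ : ℝ) ^ (k + P * q) * Q.eval ((φ σ : ℝ) ^ P)) := by
      intro σ
      simp only [g]
      rw [sq]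
      nth_rewrite 1 [Polynomial.eval_eq_sum_range]
      rw [Finset.sum_mul, Finset.mul_sum]
      refine Finset.sum_congr rfl fun q _ => ?_
      rw [pow_add, pow_mul]
      ring
    simp only [h1]
    rw [integral_finsetSum]
    · simp only [integral_const_mul, h, mul_zero, Finset.sum_const_zero]
    · intro q _
      exact (integrable_comp_continuousMap φ
        (g := fun t => t ^ (k + P * q) * Q.eval (t ^ P)) (by fun_prop)).const_mul _
  have hae := (integral_eq_zero_iff_of_nonneg hg0 (integrable_comp_continuousMap φ hg)).1 hint
  have hroot : ∀ σ ∈ U, Q.eval ((φ σ : ℝ) ^ P) = 0 := by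
    intro σ hσ
    by_contra hne
    have hpos := (Measure.mem_support_iff_forall σ).1 (hU hσ) {τ | g (φ τ) ≠ 0}
      ((isOpen_ne.preimage (hg.comp (continuous_subtype_val.comp φ.continuous))).mem_nhds
        (mul_ne_zero (pow_ne_zero _ (zero_lt_one.trans_le (φ σ).2.1).ne') (pow_ne_zero _ hne)))
    exact hpos.ne' (ae_iff.1 hae)
  refine Polynomial.eq_zero_of_infinite_isRoot Q ?_
  have hinj : InjOn (fun t : Icc (1 : ℝ) 2 => (t : ℝ) ^ P) (φ '' U) := fun s _ t _ hst =>
    Subtype.ext ((pow_left_inj₀ (zero_le_one.trans s.2.1) (zero_le_one.trans t.2.1) hP.ne').1 hst)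
  refine (hφ.image hinj).mono ?_
  rintro _ ⟨_, ⟨σ, hσ, rfl⟩, rfl⟩
  exact hroot σ hσ

end Moments

/-! ### Sufficiency -/

section Sufficiency

variable {M : Type*} [TopologicalSpace M] {n : ℕ}

open scoped Classical in
/-- The matrix `φ D B D⁻¹`, where `B` is the matrix of the adjacency `H` between the state nodes and
`D` is the diagonal matrix with entries `φ ^ (P i)`. -/
noncomputable def weightedMatrix (φ : C(M, Icc (1 : ℝ) 2))
    (H : Fin n ⊕ Unit → Fin n ⊕ Unit → Prop) (P : ℕ) : M →ᵇ (Fin n → Fin n → ℝ) :=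
  (BoundedContinuousFunction.mkOfCompact
    ⟨fun t : Icc (1 : ℝ) 2 => fun i j => if H (Sum.inl j) (Sum.inl i)
        then (t : ℝ) ^ (1 + P * (i : ℕ)) / (t : ℝ) ^ (P * (j : ℕ)) else 0, by
      refine continuous_pi fun i => continuous_pi fun j => ?_
      split_ifs
      · exact Continuous.div (by fun_prop) (by fun_prop)
          fun t => pow_ne_zero _ (zero_lt_one.trans_le t.2.1).ne'
      · exact continuous_const⟩).compContinuous φ

open scoped Classical in
/-- The input vector `D b₀`, where `b₀` is the indicator vector of the out-neighbors of the input
node for the adjacency `H`, and `D` is the diagonal matrix with entries `φ ^ (P i)`. -/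
noncomputable def weightedInput (φ : C(M, Icc (1 : ℝ) 2))
    (H : Fin n ⊕ Unit → Fin n ⊕ Unit → Prop) (P : ℕ) : M →ᵇ (Fin n → ℝ) :=
  (BoundedContinuousFunction.mkOfCompact
    ⟨fun t : Icc (1 : ℝ) 2 => fun i => if H (inputNode n) (Sum.inl i)
        then (t : ℝ) ^ (P * (i : ℕ)) else 0, by
      refine continuous_pi fun i => ?_
      split_ifs
      · fun_prop
      · exact continuous_const⟩).compContinuous φ

open scoped Classical in
lemma weightedMatrix_apply (φ : C(M, Icc (1 : ℝ) 2))
    (H : Fin n ⊕ Unit → Fin n ⊕ Unit → Prop) (P : ℕ) (σ : M) (i j : Fin n) :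
    weightedMatrix φ H P σ i j = if H (Sum.inl j) (Sum.inl i)
      then (φ σ : ℝ) ^ (1 + P * (i : ℕ)) / (φ σ : ℝ) ^ (P * (j : ℕ)) else 0 := rfl

open scoped Classical in
lemma weightedInput_apply (φ : C(M, Icc (1 : ℝ) 2))
    (H : Fin n ⊕ Unit → Fin n ⊕ Unit → Prop) (P : ℕ) (σ : M) (i : Fin n) :
    weightedInput φ H P σ i = if H (inputNode n) (Sum.inl i)
      then (φ σ : ℝ) ^ (P * (i : ℕ)) else 0 := rfl

lemma isCompliant_weighted {G : Digraph (Fin n ⊕ Unit)} (φ : C(M, Icc (1 : ℝ) 2))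
    {H : Fin n ⊕ Unit → Fin n ⊕ Unit → Prop} (hH : ∀ u v, H u v → G.Adj u v) (P : ℕ) :
    IsCompliant G (weightedMatrix φ H P) (weightedInput φ H P) := by
  classical
  rintro (j | ⟨⟩) (i | ⟨⟩) hadj
  · obtain ⟨σ, hσ⟩ := hadj
    rw [weightedMatrix_apply] at hσ
    exact hH _ _ (ite_ne_right_iff.1 hσ).1
  · exact hadj.elim
  · obtain ⟨σ, hσ⟩ := hadj
    rw [weightedInput_apply] at hσ
    exact hH _ _ (ite_ne_right_iff.1 hσ).1
  · exact hadj.elim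

lemma krylov_weighted (φ : C(M, Icc (1 : ℝ) 2)) {H : Fin n ⊕ Unit → Fin n ⊕ Unit → Prop}
    (hH : ∀ v, ¬ H v (inputNode n)) (P k : ℕ) (σ : M) (i : Fin n) :
    krylov (weightedMatrix φ H P) (weightedInput φ H P) k σ i =
      (φ σ : ℝ) ^ (k + P * (i : ℕ)) * walkCount H (inputNode n) (k + 1) (Sum.inl i) := by
  classical
  induction k generalizing i with
  | zero =>
    rw [krylov_zero, weightedInput_apply]
    have h1 : walkCount H (inputNode n) (0 + 1) (Sum.inl i) =
        if H (inputNode n) (Sum.inl i) then 1 else 0 := by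
      rw [walkCount_succ, Finset.sum_eq_single (inputNode n)
        (fun u _ hu => by simp [walkCount, hu]) (by simp)]
      simp [walkCount]
    rw [h1]
    simp
  | succ k ih =>
    have h0 : walkCount H (inputNode n) (k + 1) (Sum.inr ()) = 0 :=
      Finset.sum_eq_zero fun u _ => if_neg (hH u)
    have h1 : walkCount H (inputNode n) (k + 1 + 1) (Sum.inl i) =
        ∑ j : Fin n, if H (Sum.inl j) (Sum.inl i)
          then walkCount H (inputNode n) (k + 1) (Sum.inl j) else 0 := by
      rw [walkCount_succ, Fintype.sum_sum_type]
      simp [h0]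
    rw [krylov_succ_apply, h1, Finset.mul_sum]
    refine Finset.sum_congr rfl fun j _ => ?_
    rw [ih, weightedMatrix_apply]
    have hne : (φ σ : ℝ) ^ (P * (j : ℕ)) ≠ 0 := pow_ne_zero _ (zero_lt_one.trans_le (φ σ).2.1).ne'
    split_ifs
    · rw [← mul_assoc]
      congr 1
      rw [div_mul_eq_mul_div, div_eq_iff hne]
      ring
    · simp

variable [MeasurableSpace M] [BorelSpace M] {μ : Measure M} [IsProbabilityMeasure μ]

/-- Sufficiency: the weighted pair on the subgraph of `exists_subgraph_walkCount` is averaged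
controllable. -/
theorem isStructurallyAveragedControllable_of_isRoot {G : Digraph (Fin n ⊕ Unit)}
    (hG : IsSparsityPattern G) (hroot : IsRoot G (inputNode n))
    (hspan : HasDirectedSpanningPath (core G)) (φ : C(M, Icc (1 : ℝ) 2)) {U : Set M}
    (hne : U ⊆ μ.support) (hφ : (φ '' U).Infinite) :
    IsStructurallyAveragedControllable μ G := by
  obtain ⟨H, hH, ⟨P, K, hP, hper⟩, hcyc, hcore⟩ := exists_subgraph_walkCount
    hG.input_no_inNeighbor hG.inputNode_mem_core hroot hspan
  set W := walkCount H (inputNode n) with hW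
  refine ⟨weightedMatrix φ H P, weightedInput φ H P, isCompliant_weighted φ hH P,
    isAveragedControllable_of_krylov μ fun c hc => ?_⟩
  have hc' : ∀ k, ∑ i, c i * W (k + 1) (Sum.inl i) *
      ∫ σ, (φ σ : ℝ) ^ (k + P * (i : ℕ)) ∂μ = 0 := by
    intro k
    rw [← hc k]
    refine Finset.sum_congr rfl fun i _ => ?_
    simp only [krylov_weighted φ (fun v hv => hG.input_no_inNeighbor v (hH _ _ hv))]
    rw [integral_mul_const]
    ring
  -- Beyond `K`, the conditions along a residue class modulo `P` say that all moments of one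
  -- polynomial in `φ ^ P` vanish.
  have hlarge : ∀ k, K ≤ k → ∀ i, c i * W (k + 1) (Sum.inl i) = 0 := by
    intro k hk i
    let Q : Polynomial ℝ := ∑ i : Fin n,
      Polynomial.monomial (i : ℕ) (c i * W (k + 1) (Sum.inl i))
    have hWper : ∀ q v, W (k + P * q + 1) v = W (k + 1) v := by
      intro q v
      induction q with
      | zero => rfl
      | succ q ih =>
        rw [← ih, ← hper (k + P * q + 1) (by omega) v]
        congr 1
        ring
    have hQ : Q = 0 := by
      refine polynomial_eq_zero_of_moments φ hne hφ k hP Q fun q => ?_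
      rw [← hc' (k + P * q)]
      have h1 : ∀ σ, (φ σ : ℝ) ^ (k + P * q) * Q.eval ((φ σ : ℝ) ^ P) =
          ∑ i : Fin n, c i * W (k + 1) (Sum.inl i) * (φ σ : ℝ) ^ (k + P * q + P * (i : ℕ)) := by
        intro σ
        rw [Polynomial.eval_finsetSum, Finset.mul_sum]
        refine Finset.sum_congr rfl fun i _ => ?_
        rw [Polynomial.eval_monomial, pow_add _ (k + P * q), pow_mul _ P (i : ℕ)]
        ring
      simp only [h1]
      rw [integral_finsetSum]
      · simp only [integral_const_mul, hWper]
      · intro i _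
        exact (integrable_comp_continuousMap φ (g := fun t => t ^ (k + P * q + P * (i : ℕ)))
          (by fun_prop)).const_mul _
    have hcoeff := congrArg (fun p => Polynomial.coeff p (i : ℕ)) hQ
    simpa [Q, Polynomial.finsetSum_coeff, Polynomial.coeff_monomial, Fin.val_inj] using hcoeff
  have hcyc0 : ∀ i, Sum.inl i ∈ cycSuccessors G → c i = 0 := by
    intro i hi
    obtain ⟨k, hk, hWk⟩ := hcyc _ hi (K + 1)
    obtain ⟨k, rfl⟩ := Nat.exists_eq_succ_of_ne_zero (show k ≠ 0 by omega)
    exact (mul_eq_zero.1 (hlarge k (by omega) i)).resolve_right hWk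
  funext i
  by_cases hi : Sum.inl i ∈ cycSuccessors G
  · exact hcyc0 i hi
  obtain ⟨k, hWk, hother⟩ := hcore _ hi
  rcases k with _ | k
  · simp [hW, walkCount] at hWk
  have hsum := hc' k
  rw [Finset.sum_eq_single i] at hsum
  · have hpos : 0 < ∫ σ, (φ σ : ℝ) ^ (k + P * (i : ℕ)) ∂μ := by
      have hle : ∫ _σ : M, (1 : ℝ) ∂μ ≤ ∫ σ, (φ σ : ℝ) ^ (k + P * (i : ℕ)) ∂μ :=
        integral_mono (integrable_const _) (integrable_comp_continuousMap φ
          (g := fun t => t ^ (k + P * (i : ℕ))) (by fun_prop)) fun σ => one_le_pow₀ (φ σ).2.1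
      simp only [integral_const, probReal_univ, one_smul] at hle
      linarith
    exact (mul_eq_zero.1 ((mul_eq_zero.1 hsum).resolve_right hpos.ne')).resolve_right hWk
  · intro j _ hji
    by_cases hj : Sum.inl j ∈ cycSuccessors G
    · simp [hcyc0 j hj]
    · rw [hother _ hj fun h => hji (Sum.inl_injective h)]
      simp
  · simp

end Sufficiency

end AveragedControl

theorem theorem1
    {E : Type*} [NormedAddCommGroup E] [NormedSpace ℝ E] [FiniteDimensional ℝ E]
    (hdim : 0 < Module.finrank ℝ E)
    {H : Type*} [TopologicalSpace H] (I : ModelWithCorners ℝ E H)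
    {M : Type*} [TopologicalSpace M] [T2Space M] [SecondCountableTopology M]
    [ChartedSpace H M] [IsManifold I 0 M]
    [MeasurableSpace M] [BorelSpace M]
    (μ : MeasureTheory.Measure M) [MeasureTheory.IsProbabilityMeasure μ]
    (hμ : ∃ U : Set M, IsOpen U ∧ U.Nonempty ∧ U ⊆ μ.support)
    {n : ℕ} (G : Digraph (Fin n ⊕ Unit)) (hG : AveragedControl.IsSparsityPattern G) :
    AveragedControl.IsStructurallyAveragedControllable μ G ↔
      (AveragedControl.IsRoot G (AveragedControl.inputNode n) ∧
        AveragedControl.HasDirectedSpanningPath (AveragedControl.core G)) := by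
  constructor
  · rintro ⟨A, b, hc, h⟩
    exact ⟨AveragedControl.isRoot_of_isAveragedControllable hc h,
      AveragedControl.core_hasDirectedSpanningPath_of_isAveragedControllable hG hc h⟩
  · rintro ⟨hroot, hspan⟩
    obtain ⟨U, hU, hne, hsupp⟩ := hμ
    have : Nontrivial E := Module.nontrivial_of_finrank_pos hdim
    obtain ⟨φ, hφ⟩ := AveragedControl.exists_continuousMap_infinite_image I hU hne
    exact AveragedControl.isStructurallyAveragedControllable_of_isRoot hG hroot hspan φ hsupp hφ
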